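/- **Definitions.** A *mean payoff game* (MPG) is a finite directed graph $G=(V_0\cup V_1,E)$, with $V=V_0\cup V_1$ a disjoint union, with no loops and no parallel arcs, in which every node has at least one outgoing arc, and with a real weight $w(u,v)$ on every arc. A play starts with a pebble on some node; when the pebble is on a node of $V_p$, Player $p\in\{0,1\}$ moves it along an outgoing arc. The play ends as soon as the pebble comes back to an already visited node; Player 0 wins if the average weight of the cycle so closed is negative, otherwise Player 1 wins. A strategy may depend on all the nodes visited so far; a node $s$ is a *winning start position* of Player 1 if Player 1 has a strategy that wins every play starting at $s$. *MPG-Decision* is the problem: given an MPG, is every node a winning start position of Player 1? A *hyper temporal network* (HyTN) is $\mathcal H=(V,\mathcal A)$ with a finite set $\mathcal A$ of multi-head hyperarcs $A=(t_A,H_A,w_A)$, where $t_A\in V$, $\emptyset\ne H_A\subseteq V\setminus\{t_A\}$ and $w_A:H_A\to\mathbb R$; if $|H_A|=1$ it is a standard arc. $\mathcal H$ is *consistent* if there is $s:V\to\mathbb R$ with $s(t_A)\ge\min_{v\in H_A}\{s(v)-w_A(v)\}$ for all $A\in\mathcal A$. *HyTN-Consistency* is the problem: given a HyTN, is it consistent?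 **Theorem.** There is a log-space, linear-time, local-replacement reduction from MPG-Decision to HyTN-Consistency. In detail, for an MPG $G$ let $\mathcal H_G$ be the HyTN on the same nodes whose hyperarcs are: for every $u\in V_1$ the hyperarc $(u,N_G(u),v\mapsto w(u,v))$, where $N_G(u)$ is the set of out-neighbours of $u$; and for every arc $(u,v)\in E$ with $u\in V_0$ the standard arc $(u,v,w(u,v))$. Then: 1. for all real weights, every node of $G$ is a winning start position of Player 1 if and only if $\mathcal H_G$ is consistent; 2. $G\mapsto\mathcal H_G$ is a local replacement: there is one rule, commuting with all injective renamings of nodes, that assigns to a node with its owner and its weighted outgoing arcs a set of hyperarcs on the nodes of these arcs, and the hyperarcs of $\mathcal H_G$ are those assigned to the nodes of $G$; 3. there are a constant $c$ and a deterministic Turing machine with a read-only input tape, one work tape and a write-only output tape such that, on every word $x$ of length $N$ that encodes an MPG $G$ with rational weights, the machine halts within $c(N+1)$ steps, uses at most $c(\lfloor\log_2 N\rfloor+1)$ cells of its work tape (with $\lfloor\log_2 0\rfloor$ read as $0$), and outputs a word that encodes $\mathcal H_G$. (Nodes are numbered $0,\dots,n-1$; a game is encoded by listing its nodes with their owners,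 each followed by its outgoing arcs as triples tail, head, weight; a network is encoded by listing its nodes, each followed by its outgoing hyperarcs, given by tail and weighted heads; lists may be in any order, node numbers are written in binary and weights as reduced binary fractions.) -/

import Mathlib

/-! ### Mean payoff games (first-cycle games) -/

/-- The two players. -/
inductive Player
  | zero
  | one
  deriving DecidableEq

/-- A mean payoff game with node set `V`: `owner u` is the player who controls `u`, `out u` is the
set of out-neighbours of `u` (so `(u, v)` is an arc iff `v ∈ out u`; no parallel arcs), and `w u v`
is the real weight of the arc `(u, v)`. There are no loops, and every node has an outgoing arc.
The values of `w` outside the arcs play no role. -/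
structure MPG (V : Type*) where
  owner : V → Player
  out : V → Finset V
  w : V → V → ℝ
  no_loop : ∀ u, u ∉ out u
  exists_out : ∀ u, (out u).Nonempty

namespace MPG

variable {V : Type*}

/-- A strategy of player `p`: from the list of the previously visited nodes and the current node it
gives the next node, always along an arc when the current node belongs to `p`. -/
structure Strategy (G : MPG V) (p : Player) where
  next : List V → V → V
  legal : ∀ (h : List V) (u : V), G.owner u = p → next h u ∈ G.out u

/-- `v 0, …, v t` is a complete play: it moves along arcs, the nodes `v 0, …, v (t - 1)` are
distinct, and the last node `v t` is the already visited node `v t'`. (The values `v i` for `i > t`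
are irrelevant.) -/
structure IsPlay (G : MPG V) (v : ℕ → V) (t' t : ℕ) : Prop where
  arc : ∀ i < t, v (i + 1) ∈ G.out (v i)
  fresh : Set.InjOn v (Set.Iio t)
  lt : t' < t
  closes : v t = v t'

/-- The average weight of the cycle `v t', v (t' + 1), …, v t`. -/
noncomputable def payoff (G : MPG V) (v : ℕ → V) (t' t : ℕ) : ℝ :=
  (1 / ((t : ℝ) - (t' : ℝ))) * ∑ i ∈ Finset.Ico t' t, G.w (v i) (v (i + 1))

/-- In the play `v 0, …, v t` player `p` moves according to the strategy `σ`. -/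
def Strategy.IsFollowed {G : MPG V} {p : Player} (σ : G.Strategy p) (v : ℕ → V) (t : ℕ) : Prop :=
  ∀ i < t, G.owner (v i) = p → v (i + 1) = σ.next ((List.range i).map v) (v i)

end MPG

/-- Player 0 wins a play iff its payoff is negative; otherwise the winner is Player 1. -/
def Player.WinsWith : Player → ℝ → Prop
  | .zero, x => x < 0
  | .one, x => 0 ≤ x

/-- `s` is a winning start position of player `p`: he has a strategy with which he wins every play
that starts at `s`. -/
def MPG.IsWinningStart {V : Type*} (G : MPG V) (p : Player) (s : V) : Prop :=
  ∃ σ : G.Strategy p, ∀ (v : ℕ → V) (t' t : ℕ),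
    v 0 = s → G.IsPlay v t' t → σ.IsFollowed v t → p.WinsWith (G.payoff v t' t)

/-! ### Hyper temporal networks -/

/-- A multi-head hyperarc: a tail, a nonempty set of heads not containing the tail, and a real
weight for every head. (The weight function is normalised to `0` off the heads, so that two
hyperarcs with the same tail, heads and weights of heads are equal.) -/
@[ext]
structure Hyperarc (V : Type*) where
  tail : V
  heads : Finset V
  weight : V → ℝ
  heads_nonempty : heads.Nonempty
  tail_notMem : tail ∉ heads
  weight_off : ∀ v, v ∉ heads → weight v = 0

/-- A (multi-head) hyper temporal network on the node set `V`. -/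
structure HyTN (V : Type*) where
  arcs : Set (Hyperarc V)
  finite_arcs : arcs.Finite

/-- The network is consistent: some scheduling `s` satisfies
`s (t_A) ≥ min {s v - w_A v | v ∈ H_A}` for every hyperarc `A`. -/
def HyTN.Consistent {V : Type*} (H : HyTN V) : Prop :=
  ∃ s : V → ℝ, ∀ A ∈ H.arcs,
    s A.tail ≥ A.heads.inf' A.heads_nonempty (fun v => s v - A.weight v)

/-! ### The construction -/

namespace Hyperarc

variable {V W : Type*}

/-- The standard arc from the tail of `S` to one of its heads `v`, with the weight of `v` in `S`. -/
noncomputable def toStandardArc (S : Hyperarc V) (v : V) (hv : v ∈ S.heads) : Hyperarc V where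
  tail := S.tail
  heads := {v}
  weight := Set.indicator {v} S.weight
  heads_nonempty := Finset.singleton_nonempty v
  tail_notMem := fun h => S.tail_notMem (by rwa [Finset.mem_singleton.mp h])
  weight_off := fun u hu => Set.indicator_of_notMem (by simpa using hu) _

/-- Renaming of nodes along an injection. -/
noncomputable def map (e : V ↪ W) (S : Hyperarc V) : Hyperarc W where
  tail := e S.tail
  heads := S.heads.map e
  weight := Function.extend e S.weight 0
  heads_nonempty := S.heads_nonempty.map
  tail_notMem := by simpa using S.tail_notMem
  weight_off := by
    intro y hy
    by_cases h : ∃ a, e a = y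
    · obtain ⟨a, rfl⟩ := h
      rw [e.injective.extend_apply]
      exact S.weight_off a (fun ha => hy (Finset.mem_map_of_mem e ha))
    · rw [Function.extend_apply' _ _ _ h]
      rfl

end Hyperarc

/-- The node `u` together with its outgoing arcs. -/
noncomputable def MPG.outStar {V : Type*} (G : MPG V) (u : V) : Hyperarc V where
  tail := u
  heads := G.out u
  weight := Set.indicator (G.out u : Set V) (G.w u)
  heads_nonempty := G.exists_out u
  tail_notMem := G.no_loop u
  weight_off := fun _ hv => Set.indicator_of_notMem (by simpa using hv) _

/-- What replaces a node with its outgoing arcs, depending on the owner of the node: for Player 1,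
the one multi-head hyperarc with all the out-neighbours as heads; for Player 0, one standard arc for
each outgoing arc. -/
def replacement {V : Type*} : Player → Hyperarc V → Set (Hyperarc V)
  | .one, S => {S}
  | .zero, S => {A | ∃ (v : V) (hv : v ∈ S.heads), A = S.toStandardArc v hv}

theorem replacement_finite {V : Type*} (p : Player) (S : Hyperarc V) :
    (replacement p S).Finite := by
  cases p with
  | one => exact Set.finite_singleton S
  | zero =>
    refine (Set.finite_range (fun v : S.heads => S.toStandardArc v.1 v.2)).subset ?_
    rintro A ⟨v, hv, rfl⟩
    exact ⟨⟨v, hv⟩, rfl⟩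

/-- The network constructed from the game `G`, on the same nodes. -/
def MPG.toHyTN {V : Type*} [Finite V] (G : MPG V) : HyTN V where
  arcs := ⋃ u, replacement (G.owner u) (G.outStar u)
  finite_arcs := Set.finite_iUnion fun _ => replacement_finite _ _

/-- `f` is a local replacement: there is a rule that says which hyperarcs replace a basic unit (a
node, its owner and its outgoing arcs), such that a unit is replaced by hyperarcs on its own nodes,
such that the rule is uniform (it commutes with every injective renaming of nodes), and such that
`f n G` is obtained by replacing every unit of `G` according to the rule. -/
def IsLocalReplacement (f : ∀ n : ℕ, MPG (Fin n) → HyTN (Fin n)) : Prop :=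
  ∃ rule : ∀ n : ℕ, Player → Hyperarc (Fin n) → Set (Hyperarc (Fin n)),
    (∀ (n : ℕ) (p : Player) (S A : Hyperarc (Fin n)), A ∈ rule n p S →
      insert A.tail A.heads ⊆ insert S.tail S.heads) ∧
    (∀ (m n : ℕ) (e : Fin m ↪ Fin n) (p : Player) (S : Hyperarc (Fin m)),
      rule n p (S.map e) = Hyperarc.map e '' rule m p S) ∧
    (∀ (n : ℕ) (G : MPG (Fin n)), (f n G).arcs = ⋃ u, rule n (G.owner u) (G.outStar u))

/-! ### Turing transducers: read-only input tape, one work tape, write-only output tape -/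

/-- The content of a cell of the input tape, whose word is written between two end markers. -/
inductive InputCell (Γ : Type)
  | leftEnd
  | letter (a : Γ)
  | rightEnd

/-- A move of a head. -/
inductive HeadMove
  | left
  | stay
  | right

/-- The position after a move, from position `i`, on a tape with the cells `0, 1, 2, …`. -/
def HeadMove.apply : HeadMove → ℕ → ℕ
  | .left, i => i - 1
  | .stay, i => i
  | .right, i => i + 1

/-- A deterministic Turing machine with input and output alphabet `Γ`. From the state, the scanned
input cell and the scanned work symbol, `δ` gives the new state, the move of the input head, the
symbol to be written on the work tape, the move of the work head, and possibly a letter to be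
appended to the output; the machine halts where `δ` is `none`. -/
structure Transducer (Γ : Type) where
  State : Type
  finite_State : Finite State
  Work : Type
  finite_Work : Finite Work
  blank : Work
  start : State
  δ : State → InputCell Γ → Work →
    Option (State × HeadMove × Work × HeadMove × Option Γ)

namespace Transducer

variable {Γ : Type}

/-- The cell at position `i` of the input tape: left end marker at position `0`, the letters of `x`
at the positions `1, …, x.length`, right end marker behind them. -/
def inputCell (x : List Γ) : ℕ → InputCell Γ
  | 0 => .leftEnd
  | i + 1 =>
    match x[i]? with
    | some a => .letter a
    | none => .rightEnd

/-- A configuration. The work tape is infinite to the right. -/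
structure Cfg (M : Transducer Γ) where
  state : M.State
  inputPos : ℕ
  tape : ℕ → M.Work
  workPos : ℕ
  output : List Γ

/-- The initial configuration. -/
def init (M : Transducer Γ) : M.Cfg where
  state := M.start
  inputPos := 0
  tape := fun _ => M.blank
  workPos := 0
  output := []

/-- The action that the machine takes in a configuration, `none` if it has halted. -/
def action (M : Transducer Γ) (x : List Γ) (c : M.Cfg) :
    Option (M.State × HeadMove × M.Work × HeadMove × Option Γ) :=
  M.δ c.state (inputCell x c.inputPos) (c.tape c.workPos)

/-- One step on the input word `x`; a halted configuration does not change. The input head never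
leaves the part of the tape between the end markers. -/
def step (M : Transducer Γ) (x : List Γ) (c : M.Cfg) : M.Cfg :=
  match M.action x c with
  | none => c
  | some (q, mi, b, mw, o) =>
    { state := q
      inputPos := min (mi.apply c.inputPos) (x.length + 1)
      tape := Function.update c.tape c.workPos b
      workPos := mw.apply c.workPos
      output := c.output ++ o.toList }

/-- On input `x` the machine halts with output `y` after at most `T` steps, its work head visiting
only the first `S` cells of the work tape. -/
def Produces (M : Transducer Γ) (x y : List Γ) (T S : ℕ) : Prop :=
  ∃ t ≤ T, M.action x ((M.step x)^[t] M.init) = none ∧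
    ((M.step x)^[t] M.init).output = y ∧
    ∀ i ≤ t, ((M.step x)^[i] M.init).workPos < S

end Transducer

/-! ### Encodings of instances as words -/

/-- The letters used to write down games and networks: binary digits, the minus sign, the fraction
bar, and the marks that introduce a node of Player 0, a node of Player 1, a node of a network, the
tail of an arc or hyperarc, a head, and a weight. -/
inductive Letter
  | bit (b : Bool)
  | minus
  | slash
  | node0
  | node1
  | node
  | tail
  | head
  | weight
  deriving DecidableEq, Fintype

/-- Natural numbers in binary, least significant digit first. -/
def natWord (k : ℕ) : List Letter :=
  k.bits.map Letter.bit

/-- Rational numbers as reduced fractions in binary. -/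
def ratWord (q : ℚ) : List Letter :=
  (if q < 0 then [Letter.minus] else []) ++ natWord q.num.natAbs ++
    Letter.slash :: natWord q.den

/-- A node: a mark followed by the number of the node. -/
def nodeWord {n : ℕ} (mark : Letter) (u : Fin n) : List Letter :=
  mark :: natWord u

/-- A tail, followed by weighted heads. -/
def arcWord {n : ℕ} (u : Fin n) (heads : List (Fin n)) (q : Fin n → ℚ) : List Letter :=
  nodeWord .tail u ++
    heads.flatMap fun v => nodeWord .head v ++ Letter.weight :: ratWord (q v)

/-- `l` lists the elements of `s`, in any order and without repetitions. -/
def IsListing {α : Type*} (l : List α) (s : Set α) : Prop :=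
  l.Nodup ∧ ∀ a, a ∈ l ↔ a ∈ s

/-- The mark for a node of a game. -/
def Player.mark : Player → Letter
  | .zero => .node0
  | .one => .node1

/-- The word `x` describes the game `G`: it lists the nodes with their owners and, after each node
`u`, the arcs `(u, v, w u v)` that leave `u`, in any order. (So the weights of `G` are rational.) -/
def MPG.IsEncodedBy {n : ℕ} (G : MPG (Fin n)) (x : List Letter) : Prop :=
  ∃ (nodes : List (Fin n)) (outs : Fin n → List (Fin n)) (q : Fin n → Fin n → ℚ),
    IsListing nodes Set.univ ∧
    (∀ u, IsListing (outs u) (G.out u)) ∧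
    (∀ u, ∀ v ∈ G.out u, (q u v : ℝ) = G.w u v) ∧
    x = nodes.flatMap fun u => nodeWord (G.owner u).mark u ++
      (outs u).flatMap fun v => arcWord u [v] (q u)

/-- The word `y` describes the network `H`: it lists the nodes and, after each node `u`, the
hyperarcs with tail `u`, each given by its tail and its weighted heads, in any order. -/
def HyTN.IsEncodedBy {n : ℕ} (H : HyTN (Fin n)) (y : List Letter) : Prop :=
  ∃ (nodes : List (Fin n)) (harcs : Fin n → List (Hyperarc (Fin n)))
    (heads : Hyperarc (Fin n) → List (Fin n)) (q : Hyperarc (Fin n) → Fin n → ℚ),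
    IsListing nodes Set.univ ∧
    (∀ u, IsListing (harcs u) {A | A ∈ H.arcs ∧ A.tail = u}) ∧
    (∀ A ∈ H.arcs, IsListing (heads A) A.heads) ∧
    (∀ A ∈ H.arcs, ∀ v ∈ A.heads, (q A v : ℝ) = A.weight v) ∧
    y = nodes.flatMap fun u => nodeWord .node u ++
      (harcs u).flatMap fun A => arcWord A.tail (heads A) (q A)

/-! ### Decision problems and reductions -/

/-- A decision problem: its instances, the words that describe an instance, the yes-instances. -/
structure DecisionProblem where
  Instance : Type
  IsEncodedBy : Instance → List Letter → Prop
  IsYes : Instance → Prop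

/-- Given a mean payoff game, decide whether every node is a winning start position of Player 1. -/
def MPGDecision : DecisionProblem where
  Instance := Σ n : ℕ, MPG (Fin n)
  IsEncodedBy := fun G x => G.2.IsEncodedBy x
  IsYes := fun G => ∀ s, G.2.IsWinningStart .one s

/-- Given a hyper temporal network, decide whether it is consistent. -/
def HyTNConsistency : DecisionProblem where
  Instance := Σ n : ℕ, HyTN (Fin n)
  IsEncodedBy := fun H y => H.2.IsEncodedBy y
  IsYes := fun H => H.2.Consistent

/-- `f` is a reduction from `P` to `Q`, and one Turing transducer computes `f` on encodings, in
linear time and at the same time in logarithmic work space. -/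
def IsLogSpaceLinearTimeReduction (P Q : DecisionProblem) (f : P.Instance → Q.Instance) : Prop :=
  (∀ I : P.Instance, P.IsYes I ↔ Q.IsYes (f I)) ∧
  ∃ (M : Transducer Letter) (c : ℕ), ∀ (I : P.Instance) (x : List Letter), P.IsEncodedBy I x →
    ∃ y : List Letter, Q.IsEncodedBy (f I) y ∧
      M.Produces x y (c * (x.length + 1)) (c * (Nat.log 2 x.length + 1))

/-! ### The arcs of the network -/

/-! Consistency of the network amounts to a potential: `s v ≤ s u + w u v` on every arc leaving a
node of Player 0, and on at least one arc leaving each node of Player 1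
(`MPG.toHyTN_consistent_iff`). Given a potential, Player 1 always moves along such an arc; around
the closed cycle the differences of `s` sum to zero, so the cycle has nonnegative weight.

Conversely, fix a winning strategy for each start node, possibly depending on the history. Let `s u`
be the least weight of a simple path that ends at `u` and obeys the strategy of its own start.
Extend a lightest path to `u` by an arc that this strategy permits. Either the result is again
simple, or it closes a cycle; that cycle has nonnegative weight because the strategy wins, so the
prefix ending at the repeated node is no heavier (`MPG.IsSimplePath.exists_extend`). Hence `s` is a
potential, and memoryless determinacy is not needed.

On encodings, merging the arcs of a Player 1 node into one hyperarc only deletes the repeated tails.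
A finite-state transducer does this in one scan, without using the work tape. -/

theorem Hyperarc.eq_of_weight_eqOn {V : Type*} {A B : Hyperarc V} (ht : A.tail = B.tail)
    (hh : A.heads = B.heads) (hw : ∀ v ∈ B.heads, A.weight v = B.weight v) : A = B := by
  refine Hyperarc.ext ht hh (funext fun v => ?_)
  by_cases hv : v ∈ B.heads
  · exact hw v hv
  · rw [B.weight_off v hv, A.weight_off v (hh ▸ hv)]

theorem MPG.outStar_weight {V : Type*} (G : MPG V) {u v : V} (hv : v ∈ G.out u) :
    (G.outStar u).weight v = G.w u v :=
  Set.indicator_of_mem (by simpa using hv) _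

theorem Hyperarc.toStandardArc_weight {V : Type*} (S : Hyperarc V) (v : V) (hv : v ∈ S.heads) :
    (S.toStandardArc v hv).weight v = S.weight v :=
  Set.indicator_of_mem (Set.mem_singleton v) _

theorem MPG.toStandardArc_outStar_weight {V : Type*} (G : MPG V) {u v : V} (hv : v ∈ G.out u) :
    ((G.outStar u).toStandardArc v hv).weight v = G.w u v :=
  (Hyperarc.toStandardArc_weight _ v hv).trans (G.outStar_weight hv)

theorem MPG.mem_toHyTN_arcs {V : Type*} [Finite V] (G : MPG V) (A : Hyperarc V) :
    A ∈ G.toHyTN.arcs ↔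
      (∃ u, G.owner u = Player.one ∧ A = G.outStar u) ∨
      (∃ (u v : V) (hv : v ∈ G.out u), G.owner u = Player.zero ∧
        A = (G.outStar u).toStandardArc v hv) := by
  simp only [MPG.toHyTN, Set.mem_iUnion]
  constructor
  · rintro ⟨u, hu⟩
    cases ho : G.owner u with
    | one => rw [ho] at hu; exact Or.inl ⟨u, ho, hu⟩
    | zero =>
      rw [ho] at hu
      obtain ⟨v, hv, rfl⟩ := hu
      exact Or.inr ⟨u, v, hv, ho, rfl⟩
  · rintro (⟨u, ho, rfl⟩ | ⟨u, v, hv, ho, rfl⟩)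
    · exact ⟨u, by rw [ho]; rfl⟩
    · exact ⟨u, by rw [ho]; exact ⟨v, hv, rfl⟩⟩

theorem MPG.mem_toHyTN_arcs_iff_heads_weight {V : Type*} [Finite V] (G : MPG V) (A : Hyperarc V) :
    A ∈ G.toHyTN.arcs ↔
      (∃ u : V, G.owner u = Player.one ∧ A.tail = u ∧ A.heads = G.out u ∧
        ∀ v ∈ G.out u, A.weight v = G.w u v) ∨
      (∃ u v : V, G.owner u = Player.zero ∧ v ∈ G.out u ∧ A.tail = u ∧ A.heads = {v} ∧
        A.weight v = G.w u v) := by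
  rw [MPG.mem_toHyTN_arcs]
  constructor
  · rintro (⟨u, ho, rfl⟩ | ⟨u, v, hv, ho, rfl⟩)
    · exact Or.inl ⟨u, ho, rfl, rfl, fun v hv => G.outStar_weight hv⟩
    · exact Or.inr ⟨u, v, ho, hv, rfl, rfl,
        G.toStandardArc_outStar_weight hv⟩
  · rintro (⟨u, ho, ht, hh, hw⟩ | ⟨u, v, ho, hv, ht, hh, hw⟩)
    · exact Or.inl ⟨u, ho, Hyperarc.eq_of_weight_eqOn ht hh fun v hv =>
        (hw v hv).trans (G.outStar_weight hv).symm⟩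
    · refine Or.inr ⟨u, v, hv, ho, Hyperarc.eq_of_weight_eqOn ht hh fun x hx => ?_⟩
      obtain rfl : x = v := Finset.mem_singleton.mp hx
      exact hw.trans (G.toStandardArc_outStar_weight hv).symm

/-! ### Potentials -/

/-- `s` is a potential for Player 1: no arc of Player 0 violates `s u ≥ s v - w u v`, and at each
node of Player 1 some arc satisfies it. -/
def MPG.IsPotential {V : Type*} (G : MPG V) (s : V → ℝ) : Prop :=
  ∀ u, match G.owner u with
    | .zero => ∀ v ∈ G.out u, s v ≤ s u + G.w u v
    | .one => ∃ v ∈ G.out u, s v ≤ s u + G.w u v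

/-- A finite minimum is at most `s u` iff one of its terms is: this is the existential condition at
Player 1, while the singleton heads at Player 0 give one inequality per arc. The same `s` serves on
both sides. -/
theorem MPG.toHyTN_consistent_iff {V : Type*} [Finite V] (G : MPG V) :
    G.toHyTN.Consistent ↔ ∃ s, G.IsPotential s := by
  refine exists_congr fun s => ⟨fun h u => ?_, fun h A hA => ?_⟩
  · cases ho : G.owner u with
    | one =>
      have := h _ ((G.mem_toHyTN_arcs _).mpr (Or.inl ⟨u, ho, rfl⟩))
      obtain ⟨v, hv, hle⟩ := (Finset.inf'_le_iff _).mp this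
      have hv' : v ∈ G.out u := hv
      rw [G.outStar_weight hv'] at hle
      have hle' : s v - G.w u v ≤ s u := hle
      exact ⟨v, hv', by linarith⟩
    | zero =>
      intro v hv
      have := h _ ((G.mem_toHyTN_arcs _).mpr (Or.inr ⟨u, v, hv, ho, rfl⟩))
      obtain ⟨x, hx, hle⟩ := (Finset.inf'_le_iff _).mp this
      obtain rfl : x = v := Finset.mem_singleton.mp hx
      rw [G.toStandardArc_outStar_weight hv] at hle
      have hle' : s x - G.w u x ≤ s u := hle
      linarith
  · rcases (G.mem_toHyTN_arcs A).mp hA with ⟨u, ho, rfl⟩ | ⟨u, v, hv, ho, rfl⟩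
    · have hu := h u
      rw [ho] at hu
      obtain ⟨v, hv, hle⟩ := hu
      refine (Finset.inf'_le_iff _).mpr ⟨v, hv, ?_⟩
      rw [G.outStar_weight hv]
      show s v - G.w u v ≤ s u
      linarith
    · have hu := h u
      rw [ho] at hu
      have hle := hu v hv
      refine (Finset.inf'_le_iff _).mpr ⟨v, Finset.mem_singleton_self v, ?_⟩
      rw [G.toStandardArc_outStar_weight hv]
      show s v - G.w u v ≤ s u
      linarith

/-- The averaging factor is positive because `t' < t`, so only the sign of the total weight matters.
-/
theorem MPG.IsPlay.payoff_nonneg_iff {V : Type*} {G : MPG V} {v : ℕ → V} {t' t : ℕ}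
    (h : G.IsPlay v t' t) :
    0 ≤ G.payoff v t' t ↔ 0 ≤ ∑ i ∈ Finset.Ico t' t, G.w (v i) (v (i + 1)) := by
  have hlt : (t' : ℝ) < t := by exact_mod_cast h.lt
  exact mul_nonneg_iff_of_pos_left (one_div_pos.mpr (sub_pos.mpr hlt))

/-- A potential gives Player 1 a memoryless strategy that wins from every node. -/
theorem MPG.IsPotential.isWinningStart {V : Type*} {G : MPG V} {s : V → ℝ} (hs : G.IsPotential s)
    (u : V) : G.IsWinningStart .one u := by
  -- The inequality is demanded only at Player 1's nodes; elsewhere any out-neighbour serves to make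
  -- `f` total.
  have hex : ∀ u, ∃ v ∈ G.out u, G.owner u = .one → s v ≤ s u + G.w u v := by
    intro u
    have hu := hs u
    cases ho : G.owner u with
    | one =>
      rw [ho] at hu
      obtain ⟨v, hv, hle⟩ := hu
      exact ⟨v, hv, fun _ => hle⟩
    | zero =>
      obtain ⟨v, hv⟩ := G.exists_out u
      exact ⟨v, hv, fun h => by cases h⟩
  choose f hf hle using hex
  refine ⟨⟨fun _ => f, fun _ u _ => hf u⟩, fun v t' t _ hplay hfol => ?_⟩
  refine hplay.payoff_nonneg_iff.mpr ?_
  have hstep : ∀ i ∈ Finset.Ico t' t, s (v (i + 1)) - s (v i) ≤ G.w (v i) (v (i + 1)) := by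
    intro i hi
    have hit := (Finset.mem_Ico.mp hi).2
    cases ho : G.owner (v i) with
    | one =>
      have h1 := hfol i hit ho
      have h2 := hle (v i) ho
      rw [h1]
      show s (f (v i)) - _ ≤ G.w _ (f (v i))
      linarith
    | zero =>
      have hu := hs (v i)
      rw [ho] at hu
      have := hu _ (hplay.arc i hit)
      linarith
  have htel : ∑ i ∈ Finset.Ico t' t, (s (v (i + 1)) - s (v i)) = 0 := by
    rw [Finset.sum_Ico_sub (fun i => s (v i)) hplay.lt.le, hplay.closes, sub_self]
  exact htel ▸ Finset.sum_le_sum hstep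

/-! ### A potential from winning strategies -/

namespace MPG

variable {V : Type*} {G : MPG V}

/-- `v 0, …, v m` is a path without repeated nodes in which Player 1 moves according to the
strategy chosen for the start node. -/
structure IsSimplePath (σ : V → G.Strategy .one) (v : ℕ → V) (m : ℕ) : Prop where
  arc : ∀ i < m, v (i + 1) ∈ G.out (v i)
  inj : Set.InjOn v (Set.Iic m)
  followed : (σ (v 0)).IsFollowed v m

/-- The weight of the path `v 0, …, v m`. -/
noncomputable def pathWeight (G : MPG V) (v : ℕ → V) (m : ℕ) : ℝ :=
  ∑ i ∈ Finset.range m, G.w (v i) (v (i + 1))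

/-- The weights of the simple paths that end at `u`. -/
def pathWeights (σ : V → G.Strategy .one) (u : V) : Set ℝ :=
  {x | ∃ v m, IsSimplePath σ v m ∧ v m = u ∧ G.pathWeight v m = x}

theorem pathWeights_nonempty (σ : V → G.Strategy .one) (u : V) : (pathWeights σ u).Nonempty :=
  ⟨0, fun _ => u, 0, ⟨fun _ h => absurd h (Nat.not_lt_zero _),
    fun i hi j hj _ => (Nat.le_zero.mp hi).trans (Nat.le_zero.mp hj).symm,
    fun _ h => absurd h (Nat.not_lt_zero _)⟩, rfl, by simp [pathWeight]⟩

/-- A simple path has fewer arcs than there are nodes, so its weight is determined by one of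
finitely many vertex tuples. -/
theorem pathWeights_finite [Finite V] (σ : V → G.Strategy .one) (u : V) :
    (pathWeights σ u).Finite := by
  have : Nonempty V := ⟨u⟩
  let F : (m : Fin (Nat.card V)) × (Fin (m + 1) → V) → ℝ := fun p =>
    ∑ i : Fin p.1, G.w (p.2 i.castSucc) (p.2 i.succ)
  refine (Set.finite_range F).subset ?_
  rintro x ⟨v, m, hv, -, rfl⟩
  have hm : m < Nat.card V := by
    have hinj : Function.Injective (fun i : Fin (m + 1) => v i) := fun i j h =>
      Fin.ext (hv.inj (Nat.lt_succ_iff.mp i.2) (Nat.lt_succ_iff.mp j.2) h)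
    simpa using Nat.card_le_card_of_injective _ hinj
  refine ⟨⟨⟨m, hm⟩, fun i => v i⟩, ?_⟩
  simp [F, pathWeight, Finset.sum_range]

/-- If a simple path is extended by an arc that Player 1's strategy permits, then the new end node
is the end of a simple path that is not heavier than the extended path. -/
theorem IsSimplePath.exists_extend {σ : V → G.Strategy .one}
    (hσ : ∀ (v : ℕ → V) (t' t : ℕ), G.IsPlay v t' t → (σ (v 0)).IsFollowed v t →
      0 ≤ G.payoff v t' t)
    {v : ℕ → V} {m : ℕ} (hv : IsSimplePath σ v m) {x : V} (hx : x ∈ G.out (v m))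
    (hf : G.owner (v m) = .one → x = (σ (v 0)).next ((List.range m).map v) (v m)) :
    ∃ y ∈ pathWeights σ x, y ≤ G.pathWeight v m + G.w (v m) x := by
  classical
  set v' : ℕ → V := fun i => if i ≤ m then v i else x with hv'
  have hle : ∀ i ≤ m, v' i = v i := fun i hi => if_pos hi
  have hm1 : v' (m + 1) = x := if_neg (by omega)
  have harc : ∀ i < m + 1, v' (i + 1) ∈ G.out (v' i) := by
    intro i hi
    rcases Nat.lt_succ_iff_lt_or_eq.mp hi with h | rfl
    · rw [hle _ h, hle _ h.le]; exact hv.arc i h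
    · rw [hm1, hle _ le_rfl]; exact hx
  have hinj : Set.InjOn v' (Set.Iic m) := fun i hi j hj h => by
    rw [hle i hi, hle j hj] at h; exact hv.inj hi hj h
  have hmap : ∀ i ≤ m, (List.range i).map v' = (List.range i).map v := fun i hi =>
    List.map_congr_left fun j hj => hle j ((List.mem_range.mp hj).le.trans hi)
  have hfol : (σ (v' 0)).IsFollowed v' (m + 1) := by
    intro i hi ho
    rw [hmap i (by omega), hle 0 (Nat.zero_le _)]
    rcases Nat.lt_succ_iff_lt_or_eq.mp hi with h | rfl
    · rw [hle i h.le] at ho ⊢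
      rw [hle _ h]
      exact hv.followed i h ho
    · rw [hle i le_rfl] at ho ⊢
      rw [hm1]
      exact hf ho
  have hwt : ∀ j ≤ m, G.pathWeight v' j = G.pathWeight v j := fun j hj =>
    Finset.sum_congr rfl fun i hi => by
      have := Finset.mem_range.mp hi
      rw [hle i (by omega), hle (i + 1) (by omega)]
  have hwt1 : G.pathWeight v' (m + 1) = G.pathWeight v m + G.w (v m) x := by
    rw [← hwt m le_rfl, pathWeight, Finset.sum_range_succ, hm1, hle m le_rfl]
    rfl
  -- If `x` is already on the path, the extension is a complete play, so its cycle weighs at least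
  -- zero, and cutting it off leaves the prefix ending at `v j = x`. Otherwise the extension itself
  -- is simple.
  by_cases hex : ∃ j ≤ m, v j = x
  · obtain ⟨j, hj, hjx⟩ := hex
    have hplay : G.IsPlay v' j (m + 1) :=
      ⟨harc, fun a ha b hb h => hinj (Nat.lt_succ_iff.mp ha) (Nat.lt_succ_iff.mp hb) h,
        by omega, by rw [hm1, hle j hj, hjx]⟩
    have hcyc := hplay.payoff_nonneg_iff.mp (hσ v' j (m + 1) hplay hfol)
    refine ⟨G.pathWeight v j, ⟨v, j, ⟨fun i hi => hv.arc i (by omega),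
      hv.inj.mono (Set.Iic_subset_Iic.mpr hj), fun i hi => hv.followed i (by omega)⟩, hjx, rfl⟩, ?_⟩
    rw [← hwt1, ← hwt j hj]
    have := Finset.sum_range_add_sum_Ico (fun i => G.w (v' i) (v' (i + 1))) (by omega : j ≤ m + 1)
    unfold pathWeight
    linarith
  · push Not at hex
    refine ⟨_, ⟨v', m + 1, ⟨harc, ?_, hfol⟩, hm1, rfl⟩, hwt1.le⟩
    intro a ha b hb h
    rcases Nat.le_succ_iff.mp (Set.mem_Iic.mp ha) with ha' | rfl <;>
      rcases Nat.le_succ_iff.mp (Set.mem_Iic.mp hb) with hb' | rfl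
    · exact hinj ha' hb' h
    · rw [hle a ha', hm1] at h; exact absurd h (hex a ha')
    · rw [hle b hb', hm1] at h; exact absurd h.symm (hex b hb')
    · rfl

/-- If Player 1 wins from every node, then the least weights of the simple paths that end at the
nodes form a potential. -/
theorem exists_isPotential [Finite V] (h : ∀ s, G.IsWinningStart .one s) :
    ∃ s, G.IsPotential s := by
  choose σ hσ using h
  have hσ' : ∀ (v : ℕ → V) (t' t : ℕ), G.IsPlay v t' t → (σ (v 0)).IsFollowed v t →
      0 ≤ G.payoff v t' t := fun v t' t hp hf => hσ (v 0) v t' t rfl hp hf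
  refine ⟨fun u => sInf (pathWeights σ u), fun u => ?_⟩
  -- The infimum is attained. The lightest path `v` supplies both the strategy, that of `v 0`, and
  -- the history used at its end node.
  obtain ⟨v, m, hv, rfl, hw⟩ := (pathWeights_nonempty σ u).csInf_mem (pathWeights_finite σ u)
  have key : ∀ x ∈ G.out (v m),
      (G.owner (v m) = .one → x = (σ (v 0)).next ((List.range m).map v) (v m)) →
      sInf (pathWeights σ x) ≤ sInf (pathWeights σ (v m)) + G.w (v m) x := by
    intro x hx hf
    obtain ⟨y, hy, hle⟩ := hv.exists_extend hσ' hx hf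
    rw [← hw]
    exact (csInf_le (pathWeights_finite σ x).bddBelow hy).trans hle
  cases ho : G.owner (v m) with
  | zero => exact fun x hx => key x hx fun h => by rw [ho] at h; cases h
  | one => exact ⟨_, (σ (v 0)).legal _ _ ho, key _ ((σ (v 0)).legal _ _ ho) fun _ => rfl⟩

theorem forall_isWinningStart_iff_consistent [Finite V] (G : MPG V) :
    (∀ s, G.IsWinningStart .one s) ↔ G.toHyTN.Consistent :=
  Iff.trans ⟨exists_isPotential, fun ⟨_, hs⟩ u => hs.isWinningStart u⟩
    G.toHyTN_consistent_iff.symm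

end MPG

/-! ### Local replacement -/

theorem Hyperarc.map_toStandardArc {V W : Type*} (e : V ↪ W) (S : Hyperarc V) (v : V)
    (hv : v ∈ S.heads) :
    (S.toStandardArc v hv).map e =
      (S.map e).toStandardArc (e v) (Finset.mem_map_of_mem e hv) := by
  refine Hyperarc.eq_of_weight_eqOn rfl (Finset.map_singleton e v) fun x hx => ?_
  obtain rfl : x = e v := Finset.mem_singleton.mp hx
  refine Eq.trans ?_ (Hyperarc.toStandardArc_weight (S.map e) _ _).symm
  exact (e.injective.extend_apply _ _ v).trans
    ((S.toStandardArc_weight v hv).trans (e.injective.extend_apply _ _ v).symm)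

/-- The rule refers to nodes only through the tail, heads and weights of the star, all of which are
transported by the renaming. -/
theorem replacement_map {V W : Type*} (e : V ↪ W) (p : Player) (S : Hyperarc V) :
    replacement p (S.map e) = Hyperarc.map e '' replacement p S := by
  cases p with
  | one => exact Set.image_singleton.symm
  | zero =>
    ext A
    constructor
    · rintro ⟨y, hy, rfl⟩
      obtain ⟨v, hv, rfl⟩ := Finset.mem_map.mp hy
      exact ⟨_, ⟨v, hv, rfl⟩, Hyperarc.map_toStandardArc e S v hv⟩
    · rintro ⟨_, ⟨v, hv, rfl⟩, rfl⟩
      exact ⟨e v, Finset.mem_map_of_mem e hv, Hyperarc.map_toStandardArc e S v hv⟩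

theorem isLocalReplacement_toHyTN : IsLocalReplacement (fun _ G => G.toHyTN) := by
  refine ⟨fun _ => replacement, fun n p S A hA => ?_, fun m n e p S => ?_, fun _ _ => rfl⟩
  · cases p with
    | one =>
      obtain rfl : A = S := hA
      exact subset_rfl
    | zero =>
      obtain ⟨v, hv, rfl⟩ := hA
      exact Finset.insert_subset_insert _ (Finset.singleton_subset_iff.mpr hv)
  · exact replacement_map e p S

/-! ### Finite-state transducers as Turing transducers -/

section Mealy

variable {Γ Q : Type}

/-- The final state and the output of a finite-state transducer. -/
def mealyRun (f : Q → Γ → Q × Option Γ) : Q → List Γ → Q × List Γ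
  | q, [] => (q, [])
  | q, a :: l =>
    let r := mealyRun f (f q a).1 l
    (r.1, (f q a).2.toList ++ r.2)

theorem mealyRun_append (f : Q → Γ → Q × Option Γ) (q : Q) (l₁ l₂ : List Γ) :
    mealyRun f q (l₁ ++ l₂) =
      ((mealyRun f (mealyRun f q l₁).1 l₂).1,
        (mealyRun f q l₁).2 ++ (mealyRun f (mealyRun f q l₁).1 l₂).2) := by
  induction l₁ generalizing q with
  | nil => rfl
  | cons a l ih => simp [mealyRun, ih]

/-- The Turing transducer that scans its input once from left to right, like the finite-state
transducer with transition function `f`, and leaves its work tape alone. -/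
def Transducer.ofMealy [Finite Q] (start : Q) (f : Q → Γ → Q × Option Γ) : Transducer Γ where
  State := Q
  finite_State := inferInstance
  Work := Unit
  finite_Work := inferInstance
  blank := ()
  start := start
  δ := fun q c _ =>
    match c with
    | .leftEnd => some (q, .right, (), .stay, none)
    | .letter a => some ((f q a).1, .right, (), .stay, (f q a).2)
    | .rightEnd => none

variable [Finite Q] (start : Q) (f : Q → Γ → Q × Option Γ)

theorem Transducer.ofMealy_workPos_iterate (x : List Γ) (i : ℕ) :
    (((ofMealy start f).step x)^[i] (ofMealy start f).init).workPos = 0 := by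
  induction i with
  | zero => rfl
  | succ i ih =>
    rw [Function.iterate_succ_apply']
    generalize ((ofMealy start f).step x)^[i] (ofMealy start f).init = c at ih ⊢
    unfold Transducer.step
    cases h : (ofMealy start f).action x c with
    | none => exact ih
    | some r =>
      unfold Transducer.action at h
      cases hc : inputCell x c.inputPos <;> rw [hc] at h <;> cases h <;> exact ih

/-- Stated for an arbitrary prefix `p` already read, so that induction on the unread rest `l` goes
through. The head is at `p.length + 1` because cell `0` holds the left end marker. -/
theorem Transducer.ofMealy_iterate (p l : List Γ) (q : Q) (o : List Γ) :
    ((ofMealy start f).step (p ++ l))^[l.length] ⟨q, p.length + 1, fun _ => (), 0, o⟩ =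
      ⟨(mealyRun f q l).1, (p ++ l).length + 1, fun _ => (), 0, o ++ (mealyRun f q l).2⟩ := by
  induction l generalizing p q o with
  | nil => simp [mealyRun]
  | cons a l ih =>
    have hstep : (ofMealy start f).step (p ++ a :: l) ⟨q, p.length + 1, fun _ => (), 0, o⟩ =
        ⟨(f q a).1, (p ++ [a]).length + 1, fun _ => (), 0, o ++ (f q a).2.toList⟩ := by
      have hc : inputCell (p ++ a :: l) (p.length + 1) = .letter a := by
        simp [inputCell]
      have ha : (ofMealy start f).action (p ++ a :: l) ⟨q, p.length + 1, fun _ => (), 0, o⟩ =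
          some ((f q a).1, .right, (), .stay, (f q a).2) := by
        unfold Transducer.action
        rw [hc]
        rfl
      unfold Transducer.step
      rw [ha]
      simp [HeadMove.apply]
      rfl
    have := ih (p ++ [a]) (f q a).1 (o ++ (f q a).2.toList)
    rw [List.append_assoc, List.singleton_append] at this
    rw [List.length_cons, Function.iterate_succ_apply, hstep, this]
    simp [mealyRun]

/-- One step passes the left end marker, one step reads each letter, and the right end marker halts
the machine: `x.length + 1` steps in all. -/
theorem Transducer.ofMealy_produces (x : List Γ) {T S : ℕ} (hT : x.length + 1 ≤ T) (hS : 0 < S) :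
    (ofMealy start f).Produces x (mealyRun f start x).2 T S := by
  have hstep : (ofMealy start f).step x (ofMealy start f).init =
      ⟨start, 1, fun _ => (), 0, []⟩ := by
    unfold Transducer.step
    have ha : (ofMealy start f).action x (ofMealy start f).init =
        some (start, .right, (), .stay, none) := rfl
    rw [ha]
    simp [HeadMove.apply, Transducer.init]
    rfl
  have hrun : ((ofMealy start f).step x)^[x.length + 1] (ofMealy start f).init =
      ⟨(mealyRun f start x).1, x.length + 1, fun _ => (), 0, (mealyRun f start x).2⟩ := by
    rw [Function.iterate_succ_apply, hstep]
    exact ofMealy_iterate start f [] x start []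
  refine ⟨x.length + 1, hT, ?_, by rw [hrun], fun i _ => ?_⟩
  · rw [hrun]
    have hc : inputCell x (x.length + 1) = .rightEnd := by simp [inputCell]
    unfold Transducer.action
    rw [hc]
    rfl
  · rw [ofMealy_workPos_iterate]
    exact hS

end Mealy

/-! ### The finite-state transducer for the construction -/

/-- The states: in the block of a node of Player 0; before the first arc in the block of a node of
Player 1; behind the first tail in such a block; at a later tail in such a block. -/
inductive ReductionState
  | zero
  | first
  | rest
  | skip

instance : Finite ReductionState :=
  Finite.of_surjective
    (fun i : Fin 4 => match i with
      | 0 => ReductionState.zero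
      | 1 => .first
      | 2 => .rest
      | 3 => .skip)
    fun q => by cases q; exacts [⟨0, rfl⟩, ⟨1, rfl⟩, ⟨2, rfl⟩, ⟨3, rfl⟩]

/-- Everything is copied, except that owners are forgotten, and that in the block of a node of
Player 1 all tails but the first are deleted. -/
def reductionStep : ReductionState → Letter → ReductionState × Option Letter
  | _, .node0 => (.zero, some .node)
  | _, .node1 => (.first, some .node)
  | .zero, a => (.zero, some a)
  | .first, .tail => (.rest, some .tail)
  | .first, a => (.first, some a)
  | .rest, .tail => (.skip, none)
  | .rest, a => (.rest, some a)
  | .skip, .head => (.rest, some .head)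
  | .skip, _ => (.skip, none)

theorem mealyRun_copy {Γ Q : Type} {f : Q → Γ → Q × Option Γ} {q : Q} {l : List Γ}
    (h : ∀ a ∈ l, f q a = (q, some a)) : mealyRun f q l = (q, l) := by
  induction l with
  | nil => rfl
  | cons a l ih =>
    rw [mealyRun, h a (by simp), ih fun b hb => h b (by simp [hb])]
    rfl

theorem mealyRun_erase {Γ Q : Type} {f : Q → Γ → Q × Option Γ} {q : Q} {l : List Γ}
    (h : ∀ a ∈ l, f q a = (q, none)) : mealyRun f q l = (q, []) := by
  induction l with
  | nil => rfl
  | cons a l ih =>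
    rw [mealyRun, h a (by simp), ih fun b hb => h b (by simp [hb])]
    rfl

theorem exists_bit_of_mem_natWord {k : ℕ} {a : Letter} (h : a ∈ natWord k) :
    ∃ b, a = .bit b := by
  obtain ⟨b, -, rfl⟩ := List.mem_map.mp h
  exact ⟨b, rfl⟩

/-- A head together with its weight. -/
def headWord {n : ℕ} (q : Fin n → ℚ) (v : Fin n) : List Letter :=
  nodeWord .head v ++ Letter.weight :: ratWord (q v)

theorem mem_headWord {n : ℕ} {q : Fin n → ℚ} {v : Fin n} {a : Letter} (h : a ∈ headWord q v) :
    a ≠ .node0 ∧ a ≠ .node1 ∧ a ≠ .tail := by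
  simp only [headWord, nodeWord, ratWord, List.cons_append, List.mem_cons, List.mem_append] at h
  rcases h with rfl | h | rfl | (h | h) | rfl | h
  · simp
  · obtain ⟨b, rfl⟩ := exists_bit_of_mem_natWord h; simp
  · simp
  · split_ifs at h
    · obtain rfl := List.mem_singleton.mp h; simp
    · cases h
  · obtain ⟨b, rfl⟩ := exists_bit_of_mem_natWord h; simp
  · simp
  · obtain ⟨b, rfl⟩ := exists_bit_of_mem_natWord h; simp

theorem arcWord_eq {n : ℕ} (u : Fin n) (heads : List (Fin n)) (q : Fin n → ℚ) :
    arcWord u heads q = .tail :: (natWord u ++ heads.flatMap (headWord q)) := rfl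

theorem mealyRun_natWord {q : ReductionState} (hq : q ≠ .skip) (k : ℕ) :
    mealyRun reductionStep q (natWord k) = (q, natWord k) :=
  mealyRun_copy fun a ha => by
    obtain ⟨b, rfl⟩ := exists_bit_of_mem_natWord ha
    cases q <;> first | rfl | exact absurd rfl hq

theorem mealyRun_rest_headWord {n : ℕ} (q : Fin n → ℚ) (v : Fin n) :
    mealyRun reductionStep .rest (headWord q v) = (.rest, headWord q v) :=
  mealyRun_copy fun a ha => by
    obtain ⟨h0, h1, h2⟩ := mem_headWord ha
    cases a <;> first | rfl | contradiction

/-- The word begins with the letter `head`, on which `skip` and `rest` act alike, so the two runs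
agree by definition. -/
theorem mealyRun_skip_headWord {n : ℕ} (q : Fin n → ℚ) (v : Fin n) :
    mealyRun reductionStep .skip (headWord q v) = (.rest, headWord q v) :=
  mealyRun_rest_headWord q v

theorem mealyRun_zero_arcWords {n : ℕ} (u : Fin n) (q : Fin n → ℚ) (l : List (Fin n)) :
    mealyRun reductionStep .zero (l.flatMap fun v => arcWord u [v] q) =
      (.zero, l.flatMap fun v => arcWord u [v] q) :=
  mealyRun_copy fun a ha => by
    obtain ⟨v, -, ha⟩ := List.mem_flatMap.mp ha
    rw [arcWord_eq, List.flatMap_singleton, List.mem_cons, List.mem_append] at ha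
    rcases ha with rfl | ha | ha
    · rfl
    · obtain ⟨b, rfl⟩ := exists_bit_of_mem_natWord ha; rfl
    · obtain ⟨h0, h1, -⟩ := mem_headWord ha
      cases a <;> first | rfl | contradiction

/-- Each further tail mark switches to `skip`, which swallows the node number; the next head mark
switches back. Only the weighted heads survive. -/
theorem mealyRun_rest_arcWords {n : ℕ} (u : Fin n) (q : Fin n → ℚ) (l : List (Fin n)) :
    mealyRun reductionStep .rest (l.flatMap fun v => arcWord u [v] q) =
      (.rest, l.flatMap (headWord q)) := by
  induction l with
  | nil => rfl
  | cons v l ih =>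
    have hskip : mealyRun reductionStep .skip (natWord u) = (.skip, []) :=
      mealyRun_erase fun a ha => by
        obtain ⟨b, rfl⟩ := exists_bit_of_mem_natWord ha; rfl
    have hv : mealyRun reductionStep .rest (arcWord u [v] q) = (.rest, headWord q v) := by
      rw [arcWord_eq, List.flatMap_singleton, mealyRun]
      simp only [reductionStep]
      rw [mealyRun_append, hskip, mealyRun_skip_headWord]
      rfl
    rw [List.flatMap_cons, mealyRun_append, hv, ih]
    rfl

/-- The first tail is kept and the later ones vanish, which leaves a single hyperarc. Without arcs
there would be no tail to keep, hence `hl`. -/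
theorem mealyRun_first_arcWords {n : ℕ} (u : Fin n) (q : Fin n → ℚ) {l : List (Fin n)}
    (hl : l ≠ []) :
    mealyRun reductionStep .first (l.flatMap fun v => arcWord u [v] q) =
      (.rest, arcWord u l q) := by
  obtain ⟨v, l, rfl⟩ := List.exists_cons_of_ne_nil hl
  have hv : mealyRun reductionStep .first (arcWord u [v] q) = (.rest, arcWord u [v] q) := by
    rw [arcWord_eq, List.flatMap_singleton, mealyRun]
    simp only [reductionStep]
    rw [mealyRun_append, mealyRun_natWord (by simp), mealyRun_rest_headWord]
    rfl
  rw [List.flatMap_cons, mealyRun_append, hv, mealyRun_rest_arcWords]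
  simp [arcWord_eq]

/-- What the transducer writes for the block of the node `u`. -/
def reductionBlock {n : ℕ} (p : Player) (u : Fin n) (l : List (Fin n)) (q : Fin n → ℚ) :
    List Letter :=
  nodeWord .node u ++
    match p with
    | .zero => l.flatMap fun v => arcWord u [v] q
    | .one => arcWord u l q

/-- The node mark resets the state, so the output on a block does not depend on the state `r` left
by the preceding blocks. -/
theorem mealyRun_block {n : ℕ} (p : Player) (u : Fin n) {l : List (Fin n)} (hl : l ≠ [])
    (q : Fin n → ℚ) (r : ReductionState) :
    (mealyRun reductionStep r
      (nodeWord p.mark u ++ l.flatMap fun v => arcWord u [v] q)).2 = reductionBlock p u l q := by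
  cases p with
  | zero =>
    have h : mealyRun reductionStep r (nodeWord Player.zero.mark u) =
        (.zero, nodeWord .node u) := by
      have : reductionStep r .node0 = (.zero, some .node) := by cases r <;> rfl
      rw [nodeWord, Player.mark, mealyRun, this, mealyRun_natWord (by simp)]
      rfl
    rw [mealyRun_append, h, mealyRun_zero_arcWords]
    rfl
  | one =>
    have h : mealyRun reductionStep r (nodeWord Player.one.mark u) =
        (.first, nodeWord .node u) := by
      have : reductionStep r .node1 = (.first, some .node) := by cases r <;> rfl
      rw [nodeWord, Player.mark, mealyRun, this, mealyRun_natWord (by simp)]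
      rfl
    rw [mealyRun_append, h, mealyRun_first_arcWords u q hl]
    rfl

theorem mealyRun_flatMap_of_forall {Γ Q α : Type} {f : Q → Γ → Q × Option Γ} {l : List α}
    {g g' : α → List Γ} (h : ∀ a ∈ l, ∀ r, (mealyRun f r (g a)).2 = g' a) (r : Q) :
    (mealyRun f r (l.flatMap g)).2 = l.flatMap g' := by
  induction l generalizing r with
  | nil => rfl
  | cons a l ih =>
    rw [List.flatMap_cons, mealyRun_append, h a (by simp), ih fun b hb => h b (by simp [hb])]
    rfl

theorem MPG.isEncodedBy_toHyTN {n : ℕ} (G : MPG (Fin n)) {nodes : List (Fin n)}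
    {outs : Fin n → List (Fin n)} {q : Fin n → Fin n → ℚ} (hnodes : IsListing nodes Set.univ)
    (houts : ∀ u, IsListing (outs u) (G.out u))
    (hq : ∀ u, ∀ v ∈ G.out u, (q u v : ℝ) = G.w u v) :
    G.toHyTN.IsEncodedBy
      (nodes.flatMap fun u => reductionBlock (G.owner u) u (outs u) (q u)) := by
  have hmem : ∀ {u v}, v ∈ outs u ↔ v ∈ G.out u := fun {u v} => (houts u).2 v
  let harcs : Fin n → List (Hyperarc (Fin n)) := fun u =>
    match G.owner u with
    | .one => [G.outStar u]
    | .zero => (outs u).attach.map fun v => (G.outStar u).toStandardArc v.1 (hmem.mp v.2)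
  -- The transducer keeps the input order of heads, so a hyperarc of a Player 1 node must be listed
  -- in the order `outs`. At Player 0 the head set is a singleton and its order is no issue.
  let heads : Hyperarc (Fin n) → List (Fin n) := fun A =>
    match G.owner A.tail with
    | .one => outs A.tail
    | .zero => A.heads.toList
  have harcs_one : ∀ {u}, G.owner u = .one → harcs u = [G.outStar u] := fun {u} ho => by
    simp only [harcs]; split <;> simp_all
  have harcs_zero : ∀ {u}, G.owner u = .zero → harcs u =
      (outs u).attach.map fun v => (G.outStar u).toStandardArc v.1 (hmem.mp v.2) :=
    fun {u} ho => by simp only [harcs]; split <;> simp_all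
  have heads_one : ∀ {A : Hyperarc (Fin n)}, G.owner A.tail = .one → heads A = outs A.tail :=
    fun {A} ho => by simp only [heads]; split <;> simp_all
  have heads_zero : ∀ {A : Hyperarc (Fin n)}, G.owner A.tail = .zero →
      heads A = A.heads.toList :=
    fun {A} ho => by simp only [heads]; split <;> simp_all
  refine ⟨nodes, harcs, heads, fun A => q A.tail, hnodes, fun u => ?_, fun A hA => ?_,
    fun A hA v hv => ?_, ?_⟩
  · cases ho : G.owner u with
    | one =>
      rw [harcs_one ho]
      refine ⟨List.nodup_singleton _, fun A => ?_⟩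
      rw [List.mem_singleton, Set.mem_ofPred_eq, G.mem_toHyTN_arcs]
      constructor
      · rintro rfl
        exact ⟨Or.inl ⟨u, ho, rfl⟩, rfl⟩
      · rintro ⟨⟨u', -, rfl⟩ | ⟨u', v, hv, ho', rfl⟩, ht⟩
        · obtain rfl : u' = u := ht
          rfl
        · obtain rfl : u' = u := ht
          rw [ho] at ho'
          cases ho'
    | zero =>
      rw [harcs_zero ho]
      refine ⟨List.Nodup.map (fun a b hab => ?_) (List.nodup_attach.mpr (houts u).1), fun A => ?_⟩
      -- Standard arcs to different heads differ in their head sets, so the list has no repetitions.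
      · exact Subtype.ext (Finset.singleton_injective (congrArg Hyperarc.heads hab))
      · rw [Set.mem_ofPred_eq, G.mem_toHyTN_arcs, List.mem_map]
        constructor
        · rintro ⟨v, -, rfl⟩
          exact ⟨Or.inr ⟨u, v.1, hmem.mp v.2, ho, rfl⟩, rfl⟩
        · rintro ⟨⟨u', ho', rfl⟩ | ⟨u', v, hv, -, rfl⟩, ht⟩
          · obtain rfl : u' = u := ht
            rw [ho] at ho'
            cases ho'
          · obtain rfl : u' = u := ht
            exact ⟨⟨v, hmem.mpr hv⟩, List.mem_attach _ _, rfl⟩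
  · rcases (G.mem_toHyTN_arcs A).mp hA with ⟨u, ho, rfl⟩ | ⟨u, v, hv, ho, rfl⟩
    · rw [heads_one (A := G.outStar u) ho]
      exact houts u
    · rw [heads_zero (A := (G.outStar u).toStandardArc v hv) ho]
      exact ⟨Finset.nodup_toList _, fun a => Finset.mem_toList⟩
  · rcases (G.mem_toHyTN_arcs A).mp hA with ⟨u, ho, rfl⟩ | ⟨u, x, hx, ho, rfl⟩
    · rw [G.outStar_weight hv]
      exact hq u v hv
    · obtain rfl : v = x := Finset.mem_singleton.mp hv
      exact (hq u v hx).trans (G.toStandardArc_outStar_weight hx).symm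
  · refine List.flatMap_congr fun u _ => ?_
    unfold reductionBlock
    cases ho : G.owner u with
    | one =>
      rw [harcs_one ho, List.flatMap_singleton, heads_one (A := G.outStar u) ho]
      rfl
    | zero =>
      rw [harcs_zero ho, List.flatMap_map]
      congr 1
      conv_lhs => rw [← List.attach_map_subtype_val (outs u), List.flatMap_map]
      refine List.flatMap_congr fun v _ => ?_
      rw [heads_zero (A := (G.outStar u).toStandardArc v.1 (hmem.mp v.2)) ho]
      show _ = arcWord u (Finset.toList {v.1}) (q u)
      rw [Finset.toList_singleton]

theorem isLogSpaceLinearTimeReduction_toHyTN :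
    IsLogSpaceLinearTimeReduction MPGDecision HyTNConsistency (fun I => ⟨I.1, I.2.toHyTN⟩) := by
  refine ⟨fun I => I.2.forall_isWinningStart_iff_consistent,
    -- The start state is immaterial, since a nonempty encoding begins with a node mark. The
    -- constant `1` suffices: the scan takes `x.length + 1` steps and the work head stays in cell
    -- `0`.
    Transducer.ofMealy ReductionState.zero reductionStep, 1, ?_⟩
  rintro ⟨n, G⟩ x ⟨nodes, outs, q, hnodes, houts, hq, rfl⟩
  refine ⟨_, G.isEncodedBy_toHyTN hnodes houts hq, ?_⟩
  have hne : ∀ u, outs u ≠ [] := fun u => by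
    obtain ⟨v, hv⟩ := G.exists_out u
    exact List.ne_nil_of_mem (((houts u).2 v).mpr hv)
  rw [← mealyRun_flatMap_of_forall
    (fun u _ => mealyRun_block (G.owner u) u (hne u) (q u)) ReductionState.zero]
  exact Transducer.ofMealy_produces _ _ _ (by simp) (by simp)

theorem mainTheorem4 :
    -- the construction: one multi-head hyperarc for each node of Player 1, and one standard arc for
    -- each arc leaving a node of Player 0, with the weights of the game
    (∀ (V : Type*) [Finite V] (G : MPG V) (A : Hyperarc V),
      A ∈ G.toHyTN.arcs ↔
        (∃ u : V, G.owner u = Player.one ∧ A.tail = u ∧ A.heads = G.out u ∧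
          ∀ v ∈ G.out u, A.weight v = G.w u v) ∨
        (∃ u v : V, G.owner u = Player.zero ∧ v ∈ G.out u ∧ A.tail = u ∧ A.heads = {v} ∧
          A.weight v = G.w u v)) ∧
    -- its correctness, for arbitrary real weights
    (∀ (V : Type*) [Finite V] (G : MPG V),
      (∀ s : V, G.IsWinningStart Player.one s) ↔ G.toHyTN.Consistent) ∧
    -- it is a local replacement, and a reduction computed in logarithmic space and linear time
    IsLocalReplacement (fun _ G => G.toHyTN) ∧
    IsLogSpaceLinearTimeReduction MPGDecision HyTNConsistency (fun I => ⟨I.1, I.2.toHyTN⟩) := by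
  exact ⟨fun _ _ G A => G.mem_toHyTN_arcs_iff_heads_weight A,
    fun _ _ G => G.forall_isWinningStart_iff_consistent,
    isLocalReplacement_toHyTN, isLogSpaceLinearTimeReduction_toHyTN⟩
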